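/- Let $k\ge 2$ be an integer and let ${\bf a}=(a_n)_{n\ge 0}$ be a $k$-automatic sequence of positive integers, that is, $a_n$ is the output of a fixed finite automaton that reads the base-$k$ expansion of $n$. Let $(\varphi,\sigma,i,{\mathcal A},{\mathcal I})$ be any tuple associated with ${\bf a}$: ${\mathcal I}$ is a finite alphabet, $\sigma$ is a $k$-uniform morphism over ${\mathcal I}$ (every letter is mapped to a word of length $k$), prolongable at the letter $i\in{\mathcal I}$ (that is, $\sigma(i)$ begins with $i$), $\varphi:{\mathcal I}\to{\mathcal A}$ is a coding (a letter-to-letter map), and ${\bf a}=\varphi({\bf i})$, where ${\bf i}=\sigma^{\infty}(i)$, the limit of the words $\sigma^n(i)$, is the internal sequence. Assume that the first letter of the internal sequence ${\bf i}$ occurs at least twice in ${\bf i}$. Then the continued fraction $$\xi:=[a_0,a_1,a_2,\ldots]$$ (which converges) is not a $U_2$-number. Here, for a real number $\xi$ and an integer $n\ge 1$, $w_n(\xi)\in[-\infty,+\infty]$ denotes the supremum of the real numbers $\omega$ for which there exist infinitely many integer polynomials $P$ of degree at most $n$ with $0<|P(\xi)|\le H(P)^{-\omega}$, where $H(P)$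 is the maximum of the moduli of the coefficients of $P$; and $\xi$ is a $U_m$-number ($m\ge 1$) if $w_m(\xi)=+\infty$ and $w_n(\xi)<+\infty$ for every integer $n$ with $0<n<m$. -/

import Mathlib

open Filter Topology Polynomial

/-! ### Automatic sequences -/

/-- A `k`-automaton with state set `Q` and output alphabet `Δ`: transition function, initial state
and output function. (Finiteness of `Q` is required where automata are used.) -/
structure KAutomaton (k : ℕ) (Q Δ : Type*) where
  /-- the transition function -/
  δ : Q → Fin k → Q
  /-- the initial state -/
  q₀ : Q
  /-- the output function -/
  τ : Q → Δ

/-- The output of the automaton after reading the word `W`, first letter first. -/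
def KAutomaton.output {k : ℕ} {Q Δ : Type*} (A : KAutomaton k Q Δ) (W : List (Fin k)) : Δ :=
  A.τ (W.foldl A.δ A.q₀)

/-- The word `w₀ w₁ … w_r`, where `w_r … w₁ w₀` is the base-`k` expansion of `n`, without leading
zeros (the expansion of `0` is the one-letter word `0`). -/
def digitWord (k : ℕ) (hk : 2 ≤ k) (n : ℕ) : List (Fin k) :=
  (List.range (Nat.log k n + 1)).map fun i => ⟨n / k ^ i % k, Nat.mod_lt _ (by omega)⟩

/-- A sequence is `k`-automatic if `a n` is the output of a finite `k`-automaton reading the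
base-`k` expansion of `n`. -/
def IsAutomatic (k : ℕ) (hk : 2 ≤ k) {Δ : Type*} (a : ℕ → Δ) : Prop :=
  ∃ (Q : Type) (_ : Finite Q) (A : KAutomaton k Q Δ), ∀ n, a n = A.output (digitWord k hk n)

/-! ### Morphisms and internal sequences -/

/-- The extension of `σ : I → I*` to a morphism of the free monoid `I*`. -/
def morphExt {I : Type*} (σ : I → List I) (w : List I) : List I := w.flatMap σ

/-- `u` is the infinite word `σ^∞(i)`: the morphism `σ` is prolongable at the letter `i`, i.e.
`σ(i) = iW` with `σⁿ(W)` non-empty for all `n`, and `u` is the limit of the words `σⁿ(i)`, i.e.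
each of them is a prefix of `u`. -/
def IsMorphicLimit {I : Type*} (σ : I → List I) (i : I) (u : ℕ → I) : Prop :=
  (∃ W : List I, σ i = i :: W ∧ ∀ n : ℕ, (morphExt σ)^[n] W ≠ []) ∧
    ∀ n : ℕ, (morphExt σ)^[n] [i] =
      (List.range ((morphExt σ)^[n] [i]).length).map u

/-- A tuple `(φ, σ, i, 𝒜, ℐ)` associated with the `k`-automatic sequence `a` over `𝒜`: a
`k`-uniform morphism `σ` over the finite alphabet `I = ℐ`, a letter `i` at which it is prolongable,
and a coding `φ`, with `a = φ(σ^∞(i))`. Its internal sequence is `u = σ^∞(i)`. -/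
structure InternalTuple (k : ℕ) {Δ : Type*} (a : ℕ → Δ) where
  /-- the internal alphabet -/
  I : Type
  /-- the internal alphabet is finite -/
  finite : Finite I
  /-- the morphism on letters -/
  σ : I → List I
  /-- the morphism is `k`-uniform -/
  uniform : ∀ x, (σ x).length = k
  /-- the letter from which the internal sequence is generated -/
  i : I
  /-- the internal sequence -/
  u : ℕ → I
  /-- the internal sequence is `σ^∞(i)` -/
  limit : IsMorphicLimit σ i u
  /-- the coding -/
  φ : I → Δ
  /-- the sequence `a` is the image of the internal sequence under the coding -/
  coding : ∀ n, a n = φ (u n)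

/-! ### Continued fractions -/

/-- The infinite continued fraction `[a₀, a₁, a₂, …]`, as a formal object. -/
def contFrac (a : ℕ → ℕ) : GenContFract ℝ where
  h := a 0
  s := Stream'.Seq.ofStream fun n : ℕ => ⟨1, (a (n + 1) : ℝ)⟩

/-! ### Mahler's exponents -/

/-- `wExp n ξ` is the supremum of the real numbers `ω` such that `0 < |P(ξ)| ≤ H(P)^(-ω)` for
infinitely many integer polynomials `P` of degree at most `n`; the height `H(P)` is the maximum of
the moduli of the coefficients. -/
noncomputable def wExp (n : ℕ) (ξ : ℝ) : EReal :=
  ⨆ ω ∈ {ω : ℝ | {P : ℤ[X] | P.natDegree ≤ n ∧ 0 < |aeval ξ P| ∧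
    |aeval ξ P| ≤ P.supNorm ^ (-ω)}.Infinite}, (ω : EReal)

/-- `ξ` is a `U_m`-number, for a positive integer `m`. -/
def IsUNumber (m : ℕ) (ξ : ℝ) : Prop :=
  wExp m ξ = ⊤ ∧ ∀ n : ℕ, 0 < n → n < m → wExp n ξ < ⊤

/-! ### Complete quotients of a continued fraction with bounded partial quotients -/

/-! The value `ξ` has a family of quadratic approximations so regular that no integer polynomial of
degree at most 2 can be abnormally small at `ξ`; hence `w₂(ξ) < ∞`. Let `t > 0` be a position where
the first internal letter recurs, and put `N = k ^ n * t`. By uniformity the prefix of length `k ^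
n` recurs at `N`. The quadratic `Qₙ` attached to the period `a 0, …, a (N - 1)` satisfies `D *
|Qₙ(ξ)| = |x N - x 0|`, where `x` denotes the complete quotients and `x 0 * D` bounds the height
(`exists_quadratic_approx`). So height times value is `O(ρ ^ (-k ^ n))` with `ρ > 1`. Conversely,
there are finitely many pairs of internal letters, so either the period persists forever and `Qₙ(ξ)
= 0`, or it breaks within `O(k ^ n)` terms and `Qₙ(ξ)` is not too small
(`InternalTuple.exists_period_bound`). Given `P` of height `H`, choose `n` with `ρ ^ k ^ n` between
constant multiples of powers of `H`. As `Qₙ` is irreducible over the rationals, either its resultant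
with `P` is a nonzero integer or the two are proportional; both cases bound `|P(ξ)|` below by a
power of `H` (`resultant_bound`, `wExp_two_lt_top`). -/

theorem contFrac_convs_eq {a : ℕ → ℕ} (hpos : ∀ n, 0 < a n) (n : ℕ) :
    (contFrac a).convs n = (contFrac a).convs' n := by
  apply GenContFract.convs_eq_convs'
  intro gp m _ h
  simp only [contFrac, Stream'.Seq.get?, Stream'.Seq.ofStream] at h
  obtain rfl : (⟨1, (a (m + 1) : ℝ)⟩ : GenContFract.Pair ℝ) = gp := by
    simpa [Stream'.get, Stream'.map] using h
  exact ⟨one_pos, Nat.cast_pos.2 (hpos _)⟩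

theorem contFrac_convs_zero (a : ℕ → ℕ) : (contFrac a).convs 0 = a 0 := by
  simp [contFrac]

theorem contFrac_convs_succ {a : ℕ → ℕ} (hpos : ∀ n, 0 < a n) (n : ℕ) :
    (contFrac a).convs (n + 1) = a 0 + 1 / (contFrac fun j => a (j + 1)).convs n := by
  rw [contFrac_convs_eq hpos, contFrac_convs_eq fun j => hpos (j + 1)]
  unfold GenContFract.convs'
  rw [GenContFract.convs'Aux_succ_some (p := ⟨1, (a 1 : ℝ)⟩) rfl]
  rfl

theorem one_le_contFrac_convs (n : ℕ) :
    ∀ {a : ℕ → ℕ}, (∀ n, 0 < a n) → 1 ≤ (contFrac a).convs n := by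
  induction n with
  | zero =>
    intro a h
    rw [contFrac_convs_zero]
    exact_mod_cast h 0
  | succ n ih =>
    intro a h
    rw [contFrac_convs_succ h]
    have h1 := ih fun j => h (j + 1)
    have h2 : (1 : ℝ) ≤ a 0 := by exact_mod_cast h 0
    have : 0 ≤ 1 / (contFrac fun j => a (j + 1)).convs n := by positivity
    linarith

theorem contFrac_convs_le {b : ℕ} (n : ℕ) {a : ℕ → ℕ} (hpos : ∀ n, 0 < a n)
    (hb : ∀ n, a n ≤ b) : (contFrac a).convs n ≤ b + 1 := by
  have h2 : (a 0 : ℝ) ≤ b := by exact_mod_cast hb 0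
  cases n with
  | zero => rw [contFrac_convs_zero]; linarith
  | succ n =>
    rw [contFrac_convs_succ hpos]
    have h1 := one_le_contFrac_convs n fun j => hpos (j + 1)
    have : 1 / (contFrac fun j => a (j + 1)).convs n ≤ 1 := by
      rw [div_le_one (by linarith)]; exact h1
    linarith

theorem contFrac_convs_ge {b : ℕ} (n : ℕ) {a : ℕ → ℕ} (hpos : ∀ n, 0 < a n)
    (hb : ∀ n, a n ≤ b) : 1 + 1 / ((b : ℝ) + 1) ≤ (contFrac a).convs (n + 1) := by
  rw [contFrac_convs_succ hpos]
  have h1 := one_le_contFrac_convs n fun j => hpos (j + 1)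
  have h2 : (1 : ℝ) ≤ a 0 := by exact_mod_cast hpos 0
  have h3 := contFrac_convs_le n (fun j => hpos (j + 1)) fun j => hb (j + 1)
  have := one_div_le_one_div_of_le (by linarith) h3
  linarith

/-- The map `x ↦ 1 / x` multiplies distances by `1 / (x y)`. -/
theorem abs_add_one_div_sub (c : ℝ) {x y : ℝ} (hx : 0 < x) (hy : 0 < y) :
    |(c + 1 / x) - (c + 1 / y)| = |x - y| / (x * y) := by
  have : (c + 1 / x) - (c + 1 / y) = (y - x) / (x * y) := by field_simp; ring
  rw [this, abs_div, abs_sub_comm, abs_of_pos (mul_pos hx hy)]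

theorem abs_contFrac_convs_succ_sub_le {b : ℕ} (n : ℕ) :
    ∀ {a : ℕ → ℕ}, (∀ n, 0 < a n) → (∀ n, a n ≤ b) →
      |(contFrac a).convs (n + 1) - (contFrac a).convs n| ≤ (1 + 1 / ((b : ℝ) + 1))⁻¹ ^ n := by
  induction n with
  | zero =>
    intro a h hb
    rw [contFrac_convs_succ h, contFrac_convs_zero, contFrac_convs_zero, pow_zero]
    have h2 : (1 : ℝ) ≤ a (0 + 1) := by exact_mod_cast h 1
    rw [add_sub_cancel_left, abs_of_nonneg (by positivity), div_le_one (by linarith)]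
    exact h2
  | succ n ih =>
    intro a h hb
    have h' : ∀ j, 0 < a (j + 1) := fun j => h (j + 1)
    have hb' : ∀ j, a (j + 1) ≤ b := fun j => hb (j + 1)
    have h1 := one_le_contFrac_convs n h'
    have h2 := contFrac_convs_ge n h' hb'
    have hb0 : (0 : ℝ) < 1 + 1 / ((b : ℝ) + 1) := by positivity
    rw [contFrac_convs_succ h, contFrac_convs_succ h, abs_add_one_div_sub _ (by linarith)
      (by linarith), pow_succ, div_eq_mul_inv]
    refine mul_le_mul (ih h' hb') (inv_anti₀ hb0 (by nlinarith)) ?_ (by positivity)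
    exact inv_nonneg.2 (mul_nonneg (by linarith) (by linarith))

/-- A continued fraction with bounded positive partial quotients converges, and so do its tails;
the limits `x n` of the tails are the complete quotients. -/
theorem exists_completeQuotients {a : ℕ → ℕ} {b : ℕ} (hpos : ∀ n, 0 < a n)
    (hb : ∀ n, a n ≤ b) : ∃ x : ℕ → ℝ, Tendsto (contFrac a).convs atTop (𝓝 (x 0)) ∧
      (∀ n, 1 ≤ x n) ∧ ∀ n, x n = a n + 1 / x (n + 1) := by
  have hlim : ∀ m, ∃ y, Tendsto (contFrac fun j => a (j + m)).convs atTop (𝓝 y) := by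
    intro m
    have hr : (1 + 1 / ((b : ℝ) + 1))⁻¹ < 1 := inv_lt_one_of_one_lt₀ (by
      have : 0 < 1 / ((b : ℝ) + 1) := by positivity
      linarith)
    refine cauchySeq_tendsto_of_complete (cauchySeq_of_le_geometric _ 1 hr fun n => ?_)
    rw [dist_comm, Real.dist_eq, one_mul]
    exact abs_contFrac_convs_succ_sub_le n (fun j => hpos _) fun j => hb _
  choose x hx using hlim
  have h1 : ∀ n, 1 ≤ x n := fun n =>
    ge_of_tendsto' (hx n) fun m => one_le_contFrac_convs m fun j => hpos _
  refine ⟨x, hx 0, h1, fun n => ?_⟩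
  refine tendsto_nhds_unique ((tendsto_add_atTop_iff_nat 1).2 (hx n)) ?_
  have h2 := ((tendsto_const_nhds (x := (1 : ℝ))).div (hx (n + 1))
    (by linarith [h1 (n + 1)])).const_add (a n : ℝ)
  refine h2.congr fun m => ?_
  rw [contFrac_convs_succ fun j => hpos _]
  simp only [zero_add, add_right_comm _ 1 n, add_assoc]
  rfl

section

variable {a : ℕ → ℕ} {b : ℕ} {x : ℕ → ℝ}

theorem completeQuotient_le (hb : ∀ n, a n ≤ b) (h1 : ∀ n, 1 ≤ x n)
    (hx : ∀ n, x n = a n + 1 / x (n + 1)) (n : ℕ) : x n ≤ b + 1 := by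
  have h2 : (a n : ℝ) ≤ b := by exact_mod_cast hb n
  have : 1 / x (n + 1) ≤ 1 := by
    rw [div_le_one (by linarith [h1 (n + 1)])]; exact h1 _
  rw [hx n]; linarith

theorem completeQuotient_ge (hpos : ∀ n, 0 < a n) (hb : ∀ n, a n ≤ b) (h1 : ∀ n, 1 ≤ x n)
    (hx : ∀ n, x n = a n + 1 / x (n + 1)) (n : ℕ) : 1 + 1 / ((b : ℝ) + 1) ≤ x n := by
  have h2 : (1 : ℝ) ≤ a n := by exact_mod_cast hpos n
  have := one_div_le_one_div_of_le (by linarith [h1 (n + 1)])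
    (completeQuotient_le hb h1 hx (n + 1))
  rw [hx n]; linarith

/-- Two complete quotients whose expansions share the first `L` partial quotients are close. -/
theorem pow_mul_abs_completeQuotient_sub_le (hpos : ∀ n, 0 < a n) (hb : ∀ n, a n ≤ b)
    (h1 : ∀ n, 1 ≤ x n) (hx : ∀ n, x n = a n + 1 / x (n + 1)) (L : ℕ) :
    ∀ m n, (∀ j < L, a (m + j) = a (n + j)) →
      (1 + 1 / ((b : ℝ) + 1)) ^ L * |x m - x n| ≤ b + 1 := by
  induction L with
  | zero =>
    intro m n _
    have := completeQuotient_le hb h1 hx m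
    have := completeQuotient_le hb h1 hx n
    rw [pow_zero, one_mul, abs_le]
    constructor <;> linarith [h1 m, h1 n]
  | succ L ih =>
    intro m n h
    have ih' := ih (m + 1) (n + 1) fun j hj => by
      simpa only [add_assoc, add_comm 1 j] using h (j + 1) (by omega)
    have h0 : a m = a n := h 0 (by omega)
    rw [hx m, hx n, h0, abs_add_one_div_sub _ (by linarith [h1 (m + 1)])
      (by linarith [h1 (n + 1)])]
    refine le_trans ?_ ih'
    have hm := completeQuotient_ge hpos hb h1 hx (m + 1)
    have hn := h1 (n + 1)
    have hρ : (0 : ℝ) < 1 + 1 / ((b : ℝ) + 1) := by positivity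
    rw [pow_succ, mul_assoc]
    gcongr
    -- One denominator factor is at least `ρ` and the other at least 1, so each shared partial
    -- quotient contracts by `ρ`.
    rw [mul_div_assoc', div_le_iff₀ (by nlinarith), mul_comm]
    gcongr
    nlinarith

/-- Two complete quotients whose expansions differ at index `j` are not too close. -/
theorem one_le_pow_mul_abs_completeQuotient_sub (hb : ∀ n, a n ≤ b)
    (h1 : ∀ n, 1 ≤ x n) (hx : ∀ n, x n = a n + 1 / x (n + 1)) (j : ℕ) :
    ∀ m n, a (m + j) ≠ a (n + j) → 1 ≤ ((b : ℝ) + 1) ^ (2 * j + 1) * |x m - x n| := by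
  have base : ∀ m n, a n < a m → 1 ≤ ((b : ℝ) + 1) * |x m - x n| := by
    intro m n h
    have h2 : (a n : ℝ) + 1 ≤ a m := by exact_mod_cast h
    have hm := one_div_le_one_div_of_le (by linarith [h1 (m + 1)])
      (completeQuotient_le hb h1 hx (m + 1))
    have hn : 1 / x (n + 1) ≤ 1 := by
      rw [div_le_one (by linarith [h1 (n + 1)])]; exact h1 _
    have h3 : 1 / ((b : ℝ) + 1) ≤ |x m - x n| := by
      refine le_trans ?_ (le_abs_self _)
      rw [hx m, hx n]; linarith
    rwa [div_le_iff₀' (by positivity)] at h3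
  have base' : ∀ m n, a m ≠ a n → 1 ≤ ((b : ℝ) + 1) * |x m - x n| := by
    intro m n h
    rcases lt_or_gt_of_ne h with h | h
    · rw [abs_sub_comm]; exact base n m h
    · exact base m n h
  induction j with
  | zero => intro m n h; simpa using base' m n h
  | succ j ih =>
    intro m n h
    by_cases h0 : a m = a n
    · have ih' := ih (m + 1) (n + 1) (by
        simpa only [add_assoc, add_comm 1 j] using h)
      rw [hx m, hx n, h0, abs_add_one_div_sub _ (by linarith [h1 (m + 1)])
        (by linarith [h1 (n + 1)])]
      refine ih'.trans ?_
      have hm := completeQuotient_le hb h1 hx (m + 1)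
      have hn := completeQuotient_le hb h1 hx (n + 1)
      -- Both denominator factors are at most `b + 1`, so an inversion costs at most `(b + 1) ^ 2`.
      rw [show 2 * (j + 1) + 1 = (2 * j + 1) + 2 by ring, pow_add _ (2 * j + 1) 2, mul_assoc]
      refine mul_le_mul_of_nonneg_left ?_ (by positivity)
      rw [mul_div_assoc', le_div_iff₀ (by nlinarith [h1 (m + 1), h1 (n + 1)]), mul_comm]
      refine mul_le_mul_of_nonneg_right ?_ (abs_nonneg _)
      nlinarith [h1 (m + 1), h1 (n + 1)]
    · refine (base' m n h0).trans ?_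
      gcongr
      exact le_self_pow₀ (by linarith [(Nat.cast_nonneg b : (0 : ℝ) ≤ b)]) (by omega)

end

/-! ### Convergents -/

/-- The continuants of `a`, with initial values `u`, `v`: with initial values `0, 1` (resp. `1, 0`)
the `(n + 2)`-nd term is the numerator (resp. denominator) of the `n`-th convergent. -/
def cfContinuant (a : ℕ → ℕ) (u v : ℤ) : ℕ → ℤ
  | 0 => u
  | 1 => v
  | n + 2 => a n * cfContinuant a u v (n + 1) + cfContinuant a u v n

section

variable {a : ℕ → ℕ} {b : ℕ} {x : ℕ → ℝ}

theorem cfContinuant_succ_succ (a : ℕ → ℕ) (u v : ℤ) (n : ℕ) : cfContinuant a u v (n + 2) =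
    a n * cfContinuant a u v (n + 1) + cfContinuant a u v n := rfl

theorem cfContinuant_nonneg {u v : ℤ} (hu : 0 ≤ u) (hv : 0 ≤ v) (n : ℕ) :
    0 ≤ cfContinuant a u v n := by
  induction n using Nat.twoStepInduction with
  | zero => exact hu
  | one => exact hv
  | more n h1 h2 => rw [cfContinuant_succ_succ]; positivity

theorem cfContinuant_le {u v : ℤ} (hb : ∀ n, a n ≤ b) (hu : u ≤ 1) (hv : v ≤ 1) (hv0 : 0 ≤ v)
    (hu0 : 0 ≤ u) (n : ℕ) : cfContinuant a u v n ≤ (b + 1) ^ n := by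
  induction n using Nat.twoStepInduction with
  | zero => simpa [cfContinuant]
  | one => simp only [cfContinuant]; linarith [(Nat.cast_nonneg b : (0 : ℤ) ≤ b)]
  | more n h1 h2 =>
    rw [cfContinuant_succ_succ]
    have h3 : (a n : ℤ) ≤ b := by exact_mod_cast hb n
    have h4 : ((b : ℤ) + 1) ^ n ≤ (b + 1) ^ (n + 1) := pow_le_pow_right₀ (by omega) (by omega)
    calc (a n : ℤ) * cfContinuant a u v (n + 1) + cfContinuant a u v n
        ≤ b * (b + 1) ^ (n + 1) + (b + 1) ^ (n + 1) := by
          gcongr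
          · exact cfContinuant_nonneg hu0 hv0 _
          · exact h1.trans h4
      _ = _ := by ring

theorem cfContinuant_det (a : ℕ → ℕ) (n : ℕ) :
    cfContinuant a 0 1 (n + 1) * cfContinuant a 1 0 n -
      cfContinuant a 0 1 n * cfContinuant a 1 0 (n + 1) = (-1) ^ n := by
  induction n with
  | zero => simp [cfContinuant]
  | succ n ih =>
    rw [cfContinuant_succ_succ, cfContinuant_succ_succ, pow_succ, ← ih]; ring

theorem completeQuotient_relation (h1 : ∀ n, 1 ≤ x n) (hx : ∀ n, x n = a n + 1 / x (n + 1))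
    (n : ℕ) : x 0 * (cfContinuant a 1 0 (n + 1) * x n + cfContinuant a 1 0 n) =
      cfContinuant a 0 1 (n + 1) * x n + cfContinuant a 0 1 n := by
  induction n with
  | zero => simp [cfContinuant]
  | succ n ih =>
    have hne : x (n + 1) ≠ 0 := by linarith [h1 (n + 1)]
    rw [hx n] at ih
    field_simp at ih
    rw [cfContinuant_succ_succ, cfContinuant_succ_succ]
    push_cast
    linarith

theorem cfContinuant_growth (hpos : ∀ n, 0 < a n) (n : ℕ) : 2 ≤ cfContinuant a 0 1 (n + 3) ∧
    1 ≤ cfContinuant a 0 1 (n + 2) ∧ 1 ≤ cfContinuant a 1 0 (n + 2) ∧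
      1 ≤ cfContinuant a 1 0 (n + 3) := by
  have h : ∀ n, (1 : ℤ) ≤ a n := fun n => by exact_mod_cast hpos n
  induction n with
  | zero =>
    have := h 0
    have := h 1
    refine ⟨?_, ?_, ?_, ?_⟩ <;> simp [cfContinuant] <;> nlinarith
  | succ n ih =>
    obtain ⟨h1, h2, h3, h4⟩ := ih
    have := h (n + 2)
    refine ⟨?_, by linarith, h4, ?_⟩ <;> rw [cfContinuant_succ_succ] <;> nlinarith

end

/-! ### Comparing two quadratic polynomials at a point -/

/-- If the resultant of `aX² + bX + c` and `AX² + BX + C` vanishes, and the discriminant of the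
latter is not a square, then the two polynomials are proportional. -/
theorem proportional_of_resultant_eq_zero {a b c A B C : ℤ} (hD : ¬ IsSquare (B ^ 2 - 4 * A * C))
    (hres : (a * C - c * A) ^ 2 - (a * B - b * A) * (b * C - c * B) = 0) :
    a * B = b * A ∧ a * C = c * A := by
  have hA : A ≠ 0 := by rintro rfl; exact hD ⟨B, by ring⟩
  -- Completing the square: unless `a * B = b * A`, this exhibits the discriminant as a square.
  have key : (2 * A * (a * C - c * A) - B * (a * B - b * A)) ^ 2 =
      (B ^ 2 - 4 * A * C) * (a * B - b * A) ^ 2 := by linear_combination 4 * A ^ 2 * hres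
  have hv : a * B - b * A = 0 := by
    by_contra hv
    obtain ⟨d, hd⟩ := (Int.pow_dvd_pow_iff two_ne_zero).1 (Dvd.intro_left _ key.symm)
    rw [hd, mul_pow, mul_comm] at key
    exact hD ⟨d, by rw [← sq]; exact (mul_right_cancel₀ (pow_ne_zero 2 hv) key).symm⟩
  rw [hv, zero_mul, sub_zero] at hres
  exact ⟨sub_eq_zero.1 hv, sub_eq_zero.1 (pow_eq_zero_iff two_ne_zero |>.1 hres)⟩

/-- The resultant lies in the ideal generated by the two polynomials, so it is small when both
values `p`, `q` are; being an integer, it is then zero, which forces proportionality. -/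
theorem resultant_bound {a b c A B C : ℤ} (hD : ¬ IsSquare (B ^ 2 - 4 * A * C)) {x H h p q : ℝ}
    (ha : |(a : ℝ)| ≤ H) (hb : |(b : ℝ)| ≤ H) (hc : |(c : ℝ)| ≤ H)
    (hA : |(A : ℝ)| ≤ h) (hB : |(B : ℝ)| ≤ h) (hC : |(C : ℝ)| ≤ h)
    (hp : p = a * x ^ 2 + b * x + c) (hq : q = A * x ^ 2 + B * x + C) (hp0 : p ≠ 0) :
    1 ≤ (H * |q| + h * |p|) * (2 * H * h * (2 + |x|)) ∨ (q ≠ 0 ∧ |q| ≤ h * |p|) := by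
  by_cases hres : (a * C - c * A) ^ 2 - (a * B - b * A) * (b * C - c * B) = 0
  · right
    obtain ⟨h1, h2⟩ := proportional_of_resultant_eq_zero hD hres
    have hA0 : (A : ℝ) ≠ 0 := by
      norm_cast
      rintro rfl
      exact hD ⟨B, by ring⟩
    have h1' : (a : ℝ) * B = b * A := by exact_mod_cast h1
    have h2' : (a : ℝ) * C = c * A := by exact_mod_cast h2
    have e : A * p = a * q := by rw [hp, hq]; linear_combination -x * h1' - h2'
    have hne : (a : ℝ) * q ≠ 0 := e ▸ mul_ne_zero hA0 hp0
    have ha1 : (1 : ℝ) ≤ |(a : ℝ)| := by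
      have : a ≠ 0 := by rintro rfl; simp at hne
      exact_mod_cast Int.one_le_abs this
    refine ⟨right_ne_zero_of_mul hne, ?_⟩
    calc |q| ≤ |(a : ℝ)| * |q| := le_mul_of_one_le_left (abs_nonneg _) ha1
      _ = |(A : ℝ)| * |p| := by rw [← abs_mul, ← e, abs_mul]
      _ ≤ _ := by gcongr
  · left
    have h1 : (1 : ℝ) ≤ |(a * C - c * A : ℝ) ^ 2 - (a * B - b * A) * (b * C - c * B)| := by
      exact_mod_cast Int.one_le_abs hres
    have hH : 0 ≤ H := (abs_nonneg _).trans ha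
    have hh : 0 ≤ h := (abs_nonneg _).trans hA
    have comb : ∀ {s t y z S T : ℝ}, |s| ≤ S → |y| ≤ T → |t| ≤ S → |z| ≤ T →
        |s * y - t * z| ≤ S * T + S * T := by
      intro s t y z S T hs hy ht hz
      refine (abs_sub _ _).trans ?_
      rw [abs_mul, abs_mul]
      have := (abs_nonneg _).trans hs
      gcongr
    have e1 : |a * q - A * p| ≤ H * |q| + h * |p| := by
      refine (abs_sub _ _).trans ?_
      rw [abs_mul, abs_mul]
      gcongr
    have e3 : |B * p - b * q| ≤ H * |q| + h * |p| := by
      rw [abs_sub_comm]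
      refine (abs_sub _ _).trans ?_
      rw [abs_mul, abs_mul]
      gcongr
    have hu : |(a * C - c * A : ℝ)| ≤ 2 * H * h :=
      (comb ha hC hc hA).trans_eq (by ring)
    have hv : |(a * B - b * A : ℝ)| ≤ 2 * H * h :=
      (comb ha hB hb hA).trans_eq (by ring)
    have huv : |(a * C - c * A : ℝ) - (a * B - b * A) * x| ≤ 2 * H * h * (1 + |x|) := by
      refine (abs_sub _ _).trans ?_
      rw [abs_mul, mul_add, mul_one]
      gcongr
    have id : (a * C - c * A : ℝ) ^ 2 - (a * B - b * A) * (b * C - c * B) =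
        (a * q - A * p) * ((a * C - c * A) - (a * B - b * A) * x) +
          (a * B - b * A) * (B * p - b * q) := by
      rw [hp, hq]; ring
    rw [id] at h1
    calc 1 ≤ _ := h1
      _ ≤ |a * q - A * p| * |(a * C - c * A : ℝ) - (a * B - b * A) * x| +
          |(a * B - b * A : ℝ)| * |B * p - b * q| := by
        refine (abs_add_le _ _).trans ?_
        rw [abs_mul, abs_mul]
      _ ≤ (H * |q| + h * |p|) * (2 * H * h * (1 + |x|)) +
          2 * H * h * (H * |q| + h * |p|) := by gcongr
      _ = _ := by ring

/-! ### Finiteness of the exponent `w₂` -/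

theorem finite_natDegree_le_supNorm_le (n : ℕ) (M : ℝ) :
    {P : ℤ[X] | P.natDegree ≤ n ∧ P.supNorm ≤ M}.Finite := by
  let N : ℤ := ⌊M⌋
  have hfin : (Set.pi Set.univ fun _ : Fin (n + 1) => Set.Icc (-N) N).Finite :=
    Set.Finite.pi fun _ => Set.finite_Icc _ _
  refine Set.Finite.of_finite_image (f := fun P : ℤ[X] => fun i : Fin (n + 1) => P.coeff i)
    (hfin.subset ?_) ?_
  · rintro _ ⟨P, ⟨-, hP⟩, rfl⟩ i -
    have h := (P.le_supNorm i).trans hP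
    rw [Int.norm_eq_abs] at h
    exact abs_le.1 (Int.le_floor.2 (by exact_mod_cast h))
  · rintro P ⟨hP, -⟩ Q ⟨hQ, -⟩ h
    ext i
    by_cases hi : i < n + 1
    · exact congrFun h ⟨i, hi⟩
    · rw [coeff_eq_zero_of_natDegree_lt (by omega), coeff_eq_zero_of_natDegree_lt (by omega)]

theorem one_le_supNorm {P : ℤ[X]} (hP : P ≠ 0) : 1 ≤ P.supNorm := by
  refine le_trans ?_ (P.le_supNorm P.natDegree)
  rw [Int.norm_eq_abs]
  exact_mod_cast Int.one_le_abs (leadingCoeff_ne_zero.2 hP)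

/-- A lower bound for `|P(ξ)|` that is polynomial in the height makes the exponent finite. -/
theorem wExp_lt_top_of_lower_bound {n : ℕ} {ξ M : ℝ} {C : ℕ}
    (h : ∀ P : ℤ[X], P.natDegree ≤ n → aeval ξ P ≠ 0 → 1 ≤ M * P.supNorm ^ C * |aeval ξ P|) :
    wExp n ξ < ⊤ := by
  refine lt_of_le_of_lt ?_ (EReal.coe_lt_top ((C : ℝ) + 1))
  refine iSup₂_le fun ω hω => EReal.coe_le_coe_iff.2 ?_
  by_contra! hlt
  refine hω ((finite_natDegree_le_supNorm_le n M).subset ?_)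
  rintro P ⟨hdeg, hpos, hle⟩
  refine ⟨hdeg, ?_⟩
  have hP : aeval ξ P ≠ 0 := abs_pos.1 hpos
  have hH := one_le_supNorm (P := P) (by rintro rfl; simp at hP)
  have h1 := h P hdeg hP
  have hM : 0 < M := by
    by_contra! hM
    have : M * P.supNorm ^ C * |aeval ξ P| ≤ 0 :=
      mul_nonpos_of_nonpos_of_nonneg (mul_nonpos_of_nonpos_of_nonneg hM (by positivity))
        hpos.le
    linarith
  have h2 : |aeval ξ P| ≤ (P.supNorm ^ (C + 1))⁻¹ := by
    refine hle.trans ?_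
    rw [← Real.rpow_natCast, ← Real.rpow_neg (by linarith)]
    exact Real.rpow_le_rpow_of_exponent_le hH (by push_cast; linarith)
  have hH0 : 0 < P.supNorm := by linarith
  have h3 : 1 ≤ M * P.supNorm ^ C * (P.supNorm ^ (C + 1))⁻¹ := h1.trans (by gcongr)
  -- The powers cancel to `P.supNorm ≤ M`, which leaves finitely many `P`.
  rwa [← div_eq_mul_inv, le_div_iff₀ (by positivity), one_mul, pow_succ',
    mul_le_mul_iff_left₀ (by positivity)] at h3

/-- Take the least `n`: the preceding scale is below `K * y`, and passing to the next raises it to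
the power `k`. The condition `ρ < K` excludes `n = 0`. -/
theorem exists_scale {ρ K y : ℝ} {k : ℕ} (hρ : 1 < ρ) (hk : 2 ≤ k) (hK : ρ < K) (hy : 1 ≤ y) :
    ∃ n, 1 ≤ n ∧ K * y ≤ ρ ^ k ^ n ∧ ρ ^ k ^ n ≤ (K * y) ^ k := by
  have hex : ∃ n, K * y ≤ ρ ^ k ^ n :=
    (((tendsto_pow_atTop_atTop_of_one_lt hρ).comp
      (tendsto_pow_atTop_atTop_of_one_lt (by omega : 1 < k))).eventually_ge_atTop _).exists
  classical
  obtain ⟨n, hn, hmin⟩ : ∃ n, K * y ≤ ρ ^ k ^ n ∧ ∀ m < n, ¬ K * y ≤ ρ ^ k ^ m :=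
    ⟨Nat.find hex, Nat.find_spec hex, fun m => Nat.find_min hex⟩
  cases n with
  | zero =>
    rw [pow_zero, pow_one] at hn
    nlinarith
  | succ n =>
    refine ⟨n + 1, by omega, hn, ?_⟩
    rw [pow_succ, pow_mul]
    exact pow_le_pow_left₀ (by positivity) (not_le.1 (hmin n (by omega))).le k

/-- If `ξ` has a sequence of approximating integer quadratic polynomials `AX² + BX + C` with
non-square discriminant, whose logarithmic heights grow at most geometrically, whose values at `ξ`
are small and either vanish or are not too small, then `w₂(ξ)` is finite. -/
theorem wExp_two_lt_top {ξ ρ E κ : ℝ} {k : ℕ} (hρ : 1 < ρ) (hk : 2 ≤ k)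
    (hseq : ∀ n, 1 ≤ n → ∃ (A B C : ℤ) (h : ℝ), ¬ IsSquare (B ^ 2 - 4 * A * C) ∧
      |(A : ℝ)| ≤ h ∧ |(B : ℝ)| ≤ h ∧ |(C : ℝ)| ≤ h ∧ h ≤ E ^ k ^ n ∧
      h * |A * ξ ^ 2 + B * ξ + C| * ρ ^ k ^ n ≤ κ ∧
      (A * ξ ^ 2 + B * ξ + C = 0 ∨ 1 ≤ |A * ξ ^ 2 + B * ξ + C| * E ^ k ^ n)) :
    wExp 2 ξ < ⊤ := by
  obtain ⟨s, hs⟩ : ∃ s : ℕ, |E| ≤ ρ ^ s :=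
    ((tendsto_pow_atTop_atTop_of_one_lt hρ).eventually_ge_atTop _).exists
  -- Large enough for the `q`-term of the resultant bound to be at most `1 / 2`.
  set K : ℝ := ρ + 1 + 4 * (2 + |ξ|) * |κ| with hKdef
  have hK1 : ρ < K := by
    have : 0 ≤ 4 * (2 + |ξ|) * |κ| := by positivity
    linarith
  have hK2 : 4 * (2 + |ξ|) * κ ≤ K := by
    have : 4 * (2 + |ξ|) * κ ≤ 4 * (2 + |ξ|) * |κ| := by gcongr; exact le_abs_self _
    linarith
  refine wExp_lt_top_of_lower_bound (M := 4 * (2 + |ξ|) * K ^ (2 * s * k))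
    (C := 1 + 2 * (2 * s * k)) fun P hdeg hP => ?_
  set H := P.supNorm with hHdef
  have hH : 1 ≤ H := one_le_supNorm (by rintro rfl; simp at hP)
  obtain ⟨n, hn, hn1, hn2⟩ := exists_scale hρ hk hK1 (one_le_pow₀ hH : 1 ≤ H ^ 2)
  obtain ⟨A, B, C, h, hD, hA, hB, hC, hhE, hκ, hlow⟩ := hseq n hn
  set q := A * ξ ^ 2 + B * ξ + C with hq
  have hPeval : aeval ξ P = P.coeff 2 * ξ ^ 2 + P.coeff 1 * ξ + P.coeff 0 := by
    rw [aeval_eq_sum_range' (show P.natDegree < 3 by omega)]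
    simp [Finset.sum_range_succ]
    ring
  set p := aeval ξ P with hpdef
  have hcoeff : ∀ i, |(P.coeff i : ℝ)| ≤ H := fun i => by
    have := P.le_supNorm i
    rwa [Int.norm_eq_abs] at this
  have hh : 0 ≤ h := (abs_nonneg _).trans hA
  set S := ρ ^ k ^ n with hS
  have hS0 : 0 < S := by positivity
  have hS1 : 1 ≤ S := one_le_pow₀ hρ.le
  have hES : |E| ^ k ^ n ≤ S ^ s := by
    rw [hS, ← pow_mul, mul_comm, pow_mul]
    gcongr
  have hES' : E ^ k ^ n ≤ S ^ s := (le_abs_self _).trans ((abs_pow _ _).le.trans hES)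
  have hhS : h ≤ S ^ s := hhE.trans hES'
  have hfin : (S ^ s) ^ 2 ≤ K ^ (2 * s * k) * H ^ (2 * (2 * s * k)) := by
    calc (S ^ s) ^ 2 = S ^ (2 * s) := by rw [← pow_mul, mul_comm]
      _ ≤ ((K * H ^ 2) ^ k) ^ (2 * s) := by gcongr
      _ = _ := by
        rw [← pow_mul, mul_pow, ← pow_mul, mul_comm k]
  have hξ : 0 ≤ |ξ| := abs_nonneg _
  suffices hsuff : 1 ≤ 4 * (2 + |ξ|) * H * (S ^ s) ^ 2 * |p| by
    refine hsuff.trans ?_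
    rw [pow_add, pow_one]
    calc 4 * (2 + |ξ|) * H * (S ^ s) ^ 2 * |p|
        ≤ 4 * (2 + |ξ|) * H * (K ^ (2 * s * k) * H ^ (2 * (2 * s * k))) * |p| := by gcongr
      _ = _ := by ring
  rcases resultant_bound hD (hcoeff 2) (hcoeff 1) (hcoeff 0) hA hB hC hPeval hq hP with h1 | h1
  · have h2 : H * |q| * (2 * H * h * (2 + |ξ|)) ≤ 1 / 2 := by
      have h3 : K * H ^ 2 * (h * |q|) ≤ κ := by
        refine le_trans ?_ hκ
        rw [mul_comm _ S]
        gcongr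
      rcases le_or_gt κ 0 with hκ0 | hκ0
      · have hK0 : 0 < K := by linarith
        have : 0 ≤ h * |q| := by positivity
        have h4 : h * |q| ≤ 0 := by
          by_contra! h4
          have : 0 < K * H ^ 2 * (h * |q|) := by positivity
          linarith
        have h5 : h * |q| = 0 := le_antisymm h4 this
        have : H * |q| * (2 * H * h * (2 + |ξ|)) = (h * |q|) * (2 * H ^ 2 * (2 + |ξ|)) := by ring
        rw [this, h5]; norm_num
      · have h4 : 4 * (2 + |ξ|) * κ * H ^ 2 * (h * |q|) ≤ κ := by
          refine le_trans ?_ h3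
          gcongr
        have h5 : κ * (H * |q| * (2 * H * h * (2 + |ξ|))) ≤ κ * (1 / 2) := by linarith
        exact le_of_mul_le_mul_left h5 hκ0
    have h3 : 1 / 2 ≤ h * |p| * (2 * H * h * (2 + |ξ|)) := by linarith
    calc (1 : ℝ) ≤ 2 * (h * |p| * (2 * H * h * (2 + |ξ|))) := by linarith
      _ = 4 * (2 + |ξ|) * H * h ^ 2 * |p| := by ring
      _ ≤ _ := by gcongr
  · obtain ⟨hq0, hqp⟩ := h1
    have h2 := hlow.resolve_left hq0
    calc (1 : ℝ) ≤ |q| * E ^ k ^ n := h2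
      _ ≤ |q| * S ^ s := by gcongr
      _ ≤ (h * |p|) * S ^ s := by gcongr
      _ ≤ (S ^ s * |p|) * S ^ s := by gcongr
      _ = 1 * (S ^ s) ^ 2 * |p| := by ring
      _ ≤ _ := by
        gcongr
        nlinarith

/-! ### The internal sequence of an automatic sequence -/

theorem length_morphExt {I : Type*} {σ : I → List I} {k : ℕ} (hσ : ∀ x, (σ x).length = k)
    (w : List I) : (morphExt σ w).length = k * w.length := by
  simp [morphExt, List.length_flatMap, hσ, mul_comm]

theorem length_iterate_morphExt {I : Type*} {σ : I → List I} {k : ℕ}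
    (hσ : ∀ x, (σ x).length = k) (w : List I) (n : ℕ) :
    ((morphExt σ)^[n] w).length = k ^ n * w.length := by
  induction n with
  | zero => simp
  | succ n ih => rw [Function.iterate_succ_apply', length_morphExt hσ, ih]; ring

theorem getElem?_morphExt {I : Type*} {σ : I → List I} {k : ℕ} (hσ : ∀ x, (σ x).length = k)
    (w : List I) : ∀ j r, r < k → (morphExt σ w)[k * j + r]? = w[j]?.bind fun x => (σ x)[r]? := by
  induction w with
  | nil => simp [morphExt]
  | cons x w ih =>
    intro j r hr
    change (σ x ++ morphExt σ w)[k * j + r]? = _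
    cases j with
    | zero => rw [List.getElem?_append_left (by rw [hσ]; omega)]; simp
    | succ j =>
      have : k * (j + 1) + r - (σ x).length = k * j + r := by rw [hσ, mul_add]; omega
      rw [List.getElem?_append_right (by rw [hσ, mul_add]; omega), this, ih j r hr]
      simp

/-- The internal sequence is fixed by the morphism. -/
theorem IsMorphicLimit.getElem?_eq {I : Type*} {σ : I → List I} {i : I} {u : ℕ → I} {k : ℕ}
    (hk : 2 ≤ k) (hσ : ∀ x, (σ x).length = k) (hu : IsMorphicLimit σ i u) {r : ℕ} (hr : r < k)
    (j : ℕ) : (σ (u j))[r]? = some (u (k * j + r)) := by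
  have hlen : ∀ n, ((morphExt σ)^[n] [i]).length = k ^ n := fun n => by
    simpa using length_iterate_morphExt hσ [i] n
  have hget : ∀ n m, m < k ^ n → ((morphExt σ)^[n] [i])[m]? = some (u m) := by
    intro n m hm
    rw [hu.2 n, hlen]
    simp [hm]
  have hj : j < k ^ j := Nat.lt_pow_self (by omega)
  have h1 := hget (j + 1) (k * j + r) (by rw [pow_succ']; nlinarith)
  rw [Function.iterate_succ_apply', getElem?_morphExt hσ _ _ _ hr, hget j j hj] at h1
  simpa using h1

/-- The block of length `k ^ n` at position `k ^ n * j` depends on the letter `u j` only. -/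
theorem IsMorphicLimit.exists_block {I : Type*} {σ : I → List I} {i : I} {u : ℕ → I} {k : ℕ}
    (hk : 2 ≤ k) (hσ : ∀ x, (σ x).length = k) (hu : IsMorphicLimit σ i u) (n : ℕ) :
    ∃ f : I → ℕ → I, ∀ j r, r < k ^ n → u (k ^ n * j + r) = f (u j) r := by
  induction n with
  | zero => exact ⟨fun x _ => x, fun j r hr => by
      obtain rfl : r = 0 := by simpa using hr
      simp⟩
  | succ n ih =>
    obtain ⟨f, hf⟩ := ih
    -- The default `i` is never reached, since `r % k < k`, the length of every image.
    refine ⟨fun x r => (σ (f x (r / k)))[r % k]?.getD i, fun j r hr => ?_⟩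
    have hk0 : 0 < k := by omega
    change _ = (σ (f (u j) (r / k)))[r % k]?.getD i
    rw [← hf j (r / k) (by rwa [Nat.div_lt_iff_lt_mul hk0, ← pow_succ]),
      hu.getElem?_eq hk hσ (Nat.mod_lt _ hk0), Option.getD_some]
    congr 1
    rw [mul_add, add_assoc, Nat.div_add_mod, pow_succ]
    ring

section

variable {k : ℕ} {Δ : Type*} {a : ℕ → Δ}

theorem InternalTuple.exists_block (hk : 2 ≤ k) (T : InternalTuple k a) (n : ℕ) :
    ∃ f : T.I → ℕ → Δ, ∀ j r, r < k ^ n → a (k ^ n * j + r) = f (T.u j) r := by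
  obtain ⟨f, hf⟩ := T.limit.exists_block hk T.uniform n
  exact ⟨fun x r => T.φ (f x r), fun j r hr => by rw [T.coding, hf j r hr]⟩

theorem InternalTuple.finite_range (T : InternalTuple k a) : (Set.range a).Finite := by
  have := T.finite
  refine (Set.finite_range T.φ).subset ?_
  rintro _ ⟨n, rfl⟩
  exact ⟨T.u n, (T.coding n).symm⟩

/-- For a given `t` there is a bound `J` such that, for every `n`, either `a` has period
`k ^ n * t` or this period is broken before the index `k ^ n * J`. -/
theorem InternalTuple.exists_period_bound (hk : 2 ≤ k) (T : InternalTuple k a) (t : ℕ) :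
    ∃ J, ∀ n, (∀ r, a (k ^ n * t + r) = a r) ∨ ∃ r < k ^ n * J, a (k ^ n * t + r) ≠ a r := by
  have := T.finite
  obtain ⟨S, hS⟩ := (Set.toFinite (Set.range fun j => (T.u j, T.u (j + t)))).exists_finset_coe
  have hrep : ∀ s : S, ∃ j, (T.u j, T.u (j + t)) = s := fun s => by
    have : (s : T.I × T.I) ∈ (S : Set (T.I × T.I)) := s.2
    rwa [hS] at this
  choose g hg using hrep
  -- A break at `r` depends only on `r % k ^ n` and the letter pair at `r / k ^ n`. It therefore
  -- also occurs in the block `g` chosen for that pair, independently of `n`.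
  refine ⟨Finset.univ.sup g + 1, fun n => or_iff_not_imp_left.2 fun h => ?_⟩
  push Not at h
  obtain ⟨r, hr⟩ := h
  obtain ⟨f, hf⟩ := T.exists_block hk n
  have hkn : 0 < k ^ n := by positivity
  have hmod := Nat.mod_lt r hkn
  have hs : (T.u (r / k ^ n), T.u (r / k ^ n + t)) ∈ S := by
    rw [← Finset.mem_coe, hS]; exact ⟨_, rfl⟩
  have hj := hg ⟨_, hs⟩
  have hle : g ⟨_, hs⟩ ≤ Finset.univ.sup g := Finset.le_sup (Finset.mem_univ _)
  set j := g ⟨_, hs⟩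
  obtain ⟨hj1, hj2⟩ := Prod.ext_iff.1 hj
  refine ⟨k ^ n * j + r % k ^ n, by nlinarith, ?_⟩
  have e : ∀ m q, k ^ n * t + (k ^ n * m + q) = k ^ n * (m + t) + q := fun m q => by ring
  rw [e, hf _ _ hmod, hf _ _ hmod]
  simp only at hj1 hj2
  rw [hj1, hj2, ← hf _ _ hmod, ← hf _ _ hmod, ← e, Nat.div_add_mod]
  exact hr

theorem InternalTuple.prefix_recurs (hk : 2 ≤ k) (T : InternalTuple k a) {t : ℕ}
    (ht : T.u t = T.u 0) (n r : ℕ) (hr : r < k ^ n) : a (k ^ n * t + r) = a r := by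
  obtain ⟨f, hf⟩ := T.exists_block hk n
  have h0 := hf 0 r hr
  rw [mul_zero, zero_add] at h0
  rw [hf t r hr, ht, h0]

end

/-! ### Quadratic approximations -/

/-- The number lies strictly between consecutive squares. -/
theorem not_isSquare_sq_sub_four_mul {s e : ℤ} (hs : 3 ≤ s) (he : e = 1 ∨ e = -1) :
    ¬ IsSquare (s ^ 2 - 4 * e) := by
  rintro ⟨d, hd⟩
  have hd' : s ^ 2 - 4 * e = |d| * |d| := by rw [hd, abs_mul_abs_self]
  have h0 := abs_nonneg d
  rcases he with rfl | rfl
  · have h1 : |d| < s := by nlinarith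
    have h2 : s - 1 < |d| := by nlinarith
    omega
  · have h1 : s < |d| := by nlinarith
    have h2 : |d| < s + 1 := by nlinarith
    omega

/-- The quadratic polynomial of which the purely periodic continued fraction with period
`a 0, …, a (N - 1)` is a root: its discriminant, height and value at the continued fraction `x 0`
with partial quotients `a`. -/
theorem exists_quadratic_approx {a : ℕ → ℕ} {b : ℕ} {x : ℕ → ℝ} (hpos : ∀ n, 0 < a n)
    (hb : ∀ n, a n ≤ b) (h1 : ∀ n, 1 ≤ x n) (hx : ∀ n, x n = a n + 1 / x (n + 1)) {N : ℕ}
    (hN : 2 ≤ N) : ∃ (A B C : ℤ) (D : ℝ), ¬ IsSquare (B ^ 2 - 4 * A * C) ∧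
      0 < D ∧ |(A : ℝ)| ≤ x 0 * D ∧ |(B : ℝ)| ≤ x 0 * D ∧ |(C : ℝ)| ≤ x 0 * D ∧
      x 0 * D ≤ ((b : ℝ) + 1) ^ (N + 4) ∧
      D * |A * x 0 ^ 2 + B * x 0 + C| = |x N - x 0| := by
  have hQb := fun n => cfContinuant_le hb le_rfl zero_le_one le_rfl zero_le_one n
  obtain ⟨g1, g2, g3, g4⟩ := cfContinuant_growth hpos (N - 2)
  rw [show N - 2 + 3 = N + 1 by omega] at g1 g4
  rw [show N - 2 + 2 = N by omega] at g2 g3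
  have hdet := cfContinuant_det a N
  have hrel := completeQuotient_relation h1 hx N
  have hQb1 := hQb (N + 1)
  have hQb2 := hQb N
  generalize cfContinuant a 0 1 (N + 1) = p at *
  generalize cfContinuant a 0 1 N = p' at *
  generalize cfContinuant a 1 0 (N + 1) = q at *
  generalize cfContinuant a 1 0 N = q' at *
  have hξ := h1 0
  have hy := h1 N
  have hyb := completeQuotient_le hb h1 hx N
  have hξb := completeQuotient_le hb h1 hx 0
  generalize x 0 = ξ at *
  generalize x N = y at *
  have g1' : (2 : ℝ) ≤ p := by exact_mod_cast g1
  have g2' : (1 : ℝ) ≤ p' := by exact_mod_cast g2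
  have g3' : (1 : ℝ) ≤ q' := by exact_mod_cast g3
  have g4' : (1 : ℝ) ≤ q := by exact_mod_cast g4
  have hD : 0 < (q : ℝ) * y + q' := by positivity
  have hqD : (q : ℝ) ≤ ξ * (q * y + q') := by nlinarith
  have hq'D : (q' : ℝ) ≤ ξ * (q * y + q') := by
    nlinarith [mul_nonneg (by linarith : (0 : ℝ) ≤ q) (by linarith : (0 : ℝ) ≤ y)]
  have hpD : (p : ℝ) ≤ ξ * (q * y + q') := by rw [hrel]; nlinarith
  have hp'D : (p' : ℝ) ≤ ξ * (q * y + q') := by rw [hrel]; nlinarith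
  -- The fixed-point equation `X = (p * X + p') / (q * X + q')`; its discriminant is trace squared
  -- minus four times the determinant.
  refine ⟨q, q' - p, -p', q * y + q', ?_, hD, ?_, ?_, ?_, ?_, ?_⟩
  · rw [show (q' - p) ^ 2 - 4 * q * -p' = (q' + p) ^ 2 - 4 * (-1) ^ N by rw [← hdet]; ring]
    exact not_isSquare_sq_sub_four_mul (by linarith) (neg_one_pow_eq_or ℤ N)
  · rwa [abs_of_nonneg (by linarith)]
  · push_cast
    rw [abs_le]
    constructor <;> linarith
  · push_cast
    rwa [abs_neg, abs_of_nonneg (by linarith)]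
  · have hb1 : (1 : ℝ) ≤ b := by exact_mod_cast (hpos 0).trans_le (hb 0)
    have hq : (q : ℝ) ≤ (b + 1) ^ (N + 1) := by exact_mod_cast hQb1
    have hq' : (q' : ℝ) ≤ (b + 1) ^ N := by exact_mod_cast hQb2
    have hpow : ((b : ℝ) + 1) ^ N ≤ (b + 1) ^ (N + 2) :=
      pow_le_pow_right₀ (by linarith) (by omega)
    calc ξ * (q * y + q')
        ≤ (b + 1) * ((b + 1) ^ (N + 1) * (b + 1) + (b + 1) ^ (N + 2)) := by
          gcongr
          exact hq'.trans hpow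
      _ = (b + 1) ^ (N + 3) * 2 := by ring
      _ ≤ (b + 1) ^ (N + 3) * (b + 1) := by gcongr; linarith
      _ = _ := by ring
  · have hdetR : (p : ℝ) * q' - p' * q = (-1) ^ N := by exact_mod_cast hdet
    have e : (q * y + q') * (q * ξ ^ 2 + ((q' - p : ℤ) : ℝ) * ξ + ((-p' : ℤ) : ℝ)) =
        (-1) ^ N * (y - ξ) := by
      rw [← hdetR]
      push_cast
      linear_combination (q * ξ + q') * hrel
    rw [← abs_of_pos hD, ← abs_mul, e, abs_mul, abs_pow, abs_neg, abs_one,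
      one_pow, one_mul]

theorem theorem8 (k : ℕ) (hk : 2 ≤ k) (a : ℕ → ℕ) (hpos : ∀ n, 0 < a n)
    (ha : IsAutomatic k hk a) (T : InternalTuple k a)
    (hT : ∃ m n : ℕ, m ≠ n ∧ T.u m = T.u 0 ∧ T.u n = T.u 0) :
    ∃ ξ : ℝ, Tendsto (contFrac a).convs atTop (𝓝 ξ) ∧ ¬ IsUNumber 2 ξ := by
  obtain ⟨t, ht0, ht⟩ : ∃ t, 0 < t ∧ T.u t = T.u 0 := by
    obtain ⟨m, n, hmn, hm, hn⟩ := hT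
    rcases Nat.eq_zero_or_pos m with rfl | h
    · exact ⟨n, by omega, hn⟩
    · exact ⟨m, h, hm⟩
  obtain ⟨b, hb⟩ : ∃ b, ∀ n, a n ≤ b := by
    obtain ⟨b, hb⟩ := T.finite_range.bddAbove
    exact ⟨b, fun n => hb ⟨n, rfl⟩⟩
  obtain ⟨J, hJ⟩ := T.exists_period_bound hk t
  obtain ⟨x, hlim, h1, hx⟩ := exists_completeQuotients hpos hb
  refine ⟨x 0, hlim, fun hU => (wExp_two_lt_top (ρ := 1 + 1 / ((b : ℝ) + 1))
    -- In `E`, `t + 4` pays for the height and `2 * J + 1` for the distance lost before the period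
    -- breaks.
    (E := ((b : ℝ) + 1) ^ (t + 4 + (2 * J + 1))) (κ := x 0 * (b + 1)) ?_ hk ?_).ne hU.1⟩
  · have : 0 < 1 / ((b : ℝ) + 1) := by positivity
    linarith
  intro n hn
  have hkn : 2 ≤ k ^ n := hk.trans (Nat.le_self_pow (by omega) k)
  have hN : 2 ≤ k ^ n * t := by nlinarith
  have hb1 : (1 : ℝ) ≤ b + 1 := by linarith [(Nat.cast_nonneg b : (0 : ℝ) ≤ b)]
  obtain ⟨A, B, C, D, hsq, hD, hA, hB, hC, hle, hval⟩ := exists_quadratic_approx hpos hb h1 hx hN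
  refine ⟨A, B, C, x 0 * D, hsq, hA, hB, hC, hle.trans ?_, ?_, ?_⟩
  · rw [← pow_mul]
    refine pow_le_pow_right₀ hb1 ?_
    nlinarith
  · have hclose := pow_mul_abs_completeQuotient_sub_le hpos hb h1 hx (k ^ n) (k ^ n * t) 0
      fun j hj => by rw [T.prefix_recurs hk ht n j hj, zero_add]
    rw [mul_assoc (x 0), hval, mul_assoc, mul_comm |_|]
    exact mul_le_mul_of_nonneg_left hclose (by linarith [h1 0])
  · rcases hJ n with hper | ⟨r, hr, hne⟩
    · left
      have hρ : (1 : ℝ) < 1 + 1 / ((b : ℝ) + 1) := by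
        have : 0 < 1 / ((b : ℝ) + 1) := by positivity
        linarith
      -- All partial quotients agree, so the contraction estimate holds for every `L`.
      have hzero : |x (k ^ n * t) - x 0| = 0 := by
        by_contra hne
        have hpos' : 0 < |x (k ^ n * t) - x 0| := lt_of_le_of_ne (abs_nonneg _) (Ne.symm hne)
        obtain ⟨L, hL⟩ := ((tendsto_pow_atTop_atTop_of_one_lt hρ).eventually_gt_atTop
          (((b : ℝ) + 1) / |x (k ^ n * t) - x 0|)).exists
        rw [div_lt_iff₀ hpos'] at hL
        exact absurd (pow_mul_abs_completeQuotient_sub_le hpos hb h1 hx L (k ^ n * t) 0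
          fun j _ => by rw [hper, zero_add]) (not_le.2 hL)
      rw [hzero] at hval
      exact abs_eq_zero.1 ((mul_eq_zero.1 hval).resolve_left hD.ne')
    · right
      have hfar := one_le_pow_mul_abs_completeQuotient_sub hb h1 hx r (k ^ n * t) 0
        (by rwa [zero_add])
      have hDle : D ≤ ((b : ℝ) + 1) ^ (k ^ n * t + 4) :=
        (le_mul_of_one_le_left hD.le (h1 0)).trans hle
      rw [← hval] at hfar
      calc (1 : ℝ) ≤ _ := hfar
        _ ≤ ((b : ℝ) + 1) ^ (2 * r + 1) * (((b : ℝ) + 1) ^ (k ^ n * t + 4) *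
            |A * x 0 ^ 2 + B * x 0 + C|) := by gcongr
        _ = |A * x 0 ^ 2 + B * x 0 + C| * (b + 1) ^ (2 * r + 1 + (k ^ n * t + 4)) := by
          rw [pow_add]; ring
        _ ≤ _ := by
          rw [← pow_mul]
          refine mul_le_mul_of_nonneg_left (pow_le_pow_right₀ hb1 ?_) (abs_nonneg _)
          nlinarith
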